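/- Let $n\ge 2$ and let $\overrightarrow{C_n}$ be the directed cycle with vertex set $[n]=\{1,\dots,n\}$ and edge set $E=\{(i,i+1)\mid 1\le i<n\}\cup\{(n,1)\}$, and let $C_n$ be its underlying simple undirected graph (directions are forgotten and double edges are combined). Let $$X_{\overrightarrow{C_n}}(\mathbf x,t)=\sum_{\kappa}t^{\operatorname{asc}(\kappa)}\prod_{i=1}^n x_{\kappa(i)},$$ a formal power series in $x_1,x_2,\dots$ with coefficients in $\mathbb Q[t]$, where $\kappa$ ranges over all proper colorings $\kappa:[n]\to\{1,2,3,\dots\}$ of $C_n$ and $\operatorname{asc}(\kappa)$ is the number of edges $(i,j)\in E$ with $\kappa(i)<\kappa(j)$. For a partition $\lambda=(\lambda_1,\dots,\lambda_k)$ of $n$ let $e_\lambda=e_{\lambda_1}\cdots e_{\lambda_k}$, where $e_r$ is the $r$-th elementary symmetric function in $x_1,x_2,\dots$. Then there are unique polynomials $c_\lambda(t)\in\mathbb Q[t]$, $\lambda\vdash n$, with $$X_{\overrightarrow{C_n}}(\mathbf x,t)=\sum_{\lambda\vdash n}c_\lambda(t)\,e_\lambda(\mathbf x),$$ and they are given by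 $$c_\lambda(t)=\sum_{D\in AO_\lambda(C_n)}t^{\operatorname{asc}_{\overrightarrow{C_n}}(D)}.$$ Here $\operatorname{asc}_{\overrightarrow{C_n}}(D)$ is the number of directed edges of $\overrightarrow{C_n}$ that are oriented as in $D$, and $AO_\lambda(C_n)$ is the set of all acyclic orientations $D$ of $C_n$ such that the numbers of vertices between consecutive sinks of $D$ are $\lambda_1-1,\dots,\lambda_k-1$ in some order. A sink is a vertex with no outgoing edge. For a sink $i$, let $j$ be the first sink reached after leaving $i$ when going around the circle $1,2,\dots,n,1,\dots$ in increasing direction (so $j=i$ if $i$ is the only sink); then $i,j$ are consecutive sinks, and the vertices passed strictly between them are the vertices between them. In particular, if $D$ has only one sink, the only such number is $n-1$. -/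

import Mathlib

open scoped Polynomial

noncomputable section

namespace ChromaticDigraph

/-- The simple undirected graph underlying a digraph: orientations are removed and double edges are
combined into single edges. -/
abbrev underlying {V : Type*} (G : Digraph V) : SimpleGraph V := G.toSimpleGraphInclusive

/-- Proper colorings of a digraph by positive integers: proper colorings of the underlying graph. -/
abbrev ProperColoring {V : Type*} (G : Digraph V) : Type _ := (underlying G).Coloring ℕ+

/-- The number of ascents of `κ`: directed edges `(u, v)` of `G` with `κ u < κ v`. -/
def colorAsc {V : Type*} (G : Digraph V) (κ : ProperColoring G) : ℕ :=
  {p : V × V | G.Adj p.1 p.2 ∧ κ p.1 < κ p.2}.ncard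

/-- The exponent vector of the monomial `x_κ = ∏ v, x_{κ v}`. -/
def colorWeight {V : Type*} [Fintype V] (G : Digraph V) (κ : ProperColoring G) : ℕ+ →₀ ℕ :=
  ∑ v, Finsupp.single (κ v) 1

/-- Only finitely many proper colorings have a given monomial, so the sum in
`chromaticQuasisymmetric` below is a genuine finite sum. -/
theorem finite_colorWeight_eq {V : Type*} [Fintype V] (G : Digraph V) (m : ℕ+ →₀ ℕ) :
    {κ : ProperColoring G | colorWeight G κ = m}.Finite := by
  classical
  have h : (Set.pi Set.univ fun _ : V => (m.support : Set ℕ+)).Finite :=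
    Set.Finite.pi fun _ => m.support.finite_toSet
  refine Set.Finite.of_injOn (f := fun (κ : ProperColoring G) (v : V) => κ v) ?_
    (fun κ _ κ' _ e => DFunLike.coe_injective e) h
  rintro κ rfl v -
  simp only [Finset.mem_coe, Finsupp.mem_support_iff, colorWeight, Finsupp.finsetSum_apply]
  intro h0
  have := (Finset.sum_eq_zero_iff.1 h0) v (Finset.mem_univ v)
  simp at this

/-- The chromatic quasisymmetric function `∑_κ t ^ asc(κ) x_κ` of a finite digraph, over all proper
colorings `κ`, as a formal power series in the variables `x₁, x₂, …` with coefficients in `ℚ[t]`. -/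
def chromaticQuasisymmetric {V : Type*} [Fintype V] (G : Digraph V) : MvPowerSeries ℕ+ ℚ[X] :=
  fun m => ∑ᶠ κ ∈ {κ : ProperColoring G | colorWeight G κ = m}, (Polynomial.X : ℚ[X]) ^ colorAsc G κ

open Classical in
/-- The elementary symmetric function `e_k` in `x₁, x₂, …`: the sum of all squarefree monomials of
degree `k`. -/
def elementary (k : ℕ) : MvPowerSeries ℕ+ ℚ[X] :=
  fun m => if (∀ i, m i ≤ 1) ∧ m.degree = k then 1 else 0

/-- `e_λ`, the product of the `e_{λ_i}` over the parts of `λ`. -/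
def elementaryPart {n : ℕ} (lam : n.Partition) : MvPowerSeries ℕ+ ℚ[X] :=
  (lam.parts.map elementary).prod

/-- `D` is an acyclic orientation of the graph `G`: each edge of `G` gets exactly one of its two
directions, and there is no directed closed walk of positive length. -/
structure IsAcyclicOrientation {V : Type*} (G : SimpleGraph V) (D : Digraph V) : Prop where
  adj_iff : ∀ u v, G.Adj u v ↔ D.Adj u v ∨ D.Adj v u
  antisymm : ∀ u v, D.Adj u v → ¬ D.Adj v u
  acyclic : ∀ v, ¬ Relation.TransGen D.Adj v v

/-- The number of directed edges of `G` that are oriented as in `D`. -/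
def orientationAsc {V : Type*} (G D : Digraph V) : ℕ :=
  {p : V × V | G.Adj p.1 p.2 ∧ D.Adj p.1 p.2}.ncard

/-- A sink: a vertex with no outgoing edge. -/
def IsSink {V : Type*} (D : Digraph V) (v : V) : Prop := ∀ w, ¬ D.Adj v w

/-- The directed cycle `0 → 1 → ⋯ → n - 1 → 0` (the vertices `1, …, n` are numbered from `0`). -/
def directedCycle (n : ℕ) : Digraph (Fin n) where
  Adj i j := i.val + 1 = j.val ∨ (i.val + 1 = n ∧ j.val = 0)

/-- The vertices strictly between `i` and `j` when one goes around the circle `0, 1, …, n - 1` from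
`i` in increasing direction until `j` is reached for the first time; if `i = j` one goes around once,
so these are all the other vertices. (`k - i` is subtraction modulo `n`.) -/
def between {n : ℕ} (i j : Fin n) : Finset (Fin n) :=
  {k | 0 < (k - i).val ∧ (k - i).val < if i = j then n else (j - i).val}

/-- `i` and `j` are sinks and there is no other sink on the way around the circle from `i` to `j`.
If there is only one sink, it is consecutive to itself. -/
def ConsecutiveSinks {n : ℕ} (D : Digraph (Fin n)) (i j : Fin n) : Prop :=
  IsSink D i ∧ IsSink D j ∧ ∀ k ∈ between i j, ¬ IsSink D k

open Classical in
/-- The multiset of the numbers of vertices between consecutive sinks. -/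
def sinkGaps {n : ℕ} (D : Digraph (Fin n)) : Multiset ℕ :=
  (Finset.univ.filter fun p : Fin n × Fin n => ConsecutiveSinks D p.1 p.2).val.map
    fun p => (between p.1 p.2).card

open Classical in
/-- The acyclic orientations of the undirected cycle `C_n` for which the numbers of vertices between
consecutive sinks are `λ_1 - 1, …, λ_k - 1` in some order. -/
def acyclicOrientations {n : ℕ} (lam : n.Partition) : Finset (Digraph (Fin n)) :=
  {D | IsAcyclicOrientation (underlying (directedCycle n)) D ∧
    sinkGaps D = lam.parts.map fun a => a - 1}

end ChromaticDigraph

end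

/-! Both sides are traces of `n`-th powers of matrices, and the two matrices have the same reverse
characteristic polynomial `det (1 - X M)`. By Newton's identities (`charpolyRev_mul_trace`) this
polynomial determines the traces of all positive powers.

In finitely many variables, a proper coloring of the cycle is a closed walk on the colors, so the
chromatic function is a trace of a power of `colorMatrix` (`restrict_chromaticQuasisymmetric`). A
rank-one perturbation makes the determinant triangular in two ways, whence `(t - 1) det (1 - X M) =
t ∏ (1 + x_i X) - ∏ (1 + t x_i X)`. Dividing by `t - 1` gives `1 - ∑ e_k (t + ⋯ + t^(k-1)) X^k`.

On the other side, an acyclic orientation is a cyclic word of edge directions with at least one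
sink. The sinks cut it into arcs; in an arc with `k` edges all backward edges precede all forward
ones and both kinds occur, so its weight is `t + ⋯ + t^(k-1)`. An automaton that reads the word and
emits `e_k` when such an arc ends has the same reverse characteristic polynomial
(`charpolyRev_transitionMatrix`), and its closed walks are the words with a sink
(`trace_transitionMatrix_pow`).

Uniqueness of the coefficients is the algebraic independence of the elementary symmetric polynomials
(`elementaryPart_independent`). -/

open scoped Polynomial

noncomputable section

namespace ChromaticDigraph

/-! ### Traces of matrix powers: Newton's identities and closed walks. -/

section Trace

open Matrix Polynomial

variable {R : Type*} [CommRing R] {ι : Type*} [Fintype ι] [DecidableEq ι]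

/-- Jacobi's formula for matrices of polynomials. -/
theorem derivative_det (B : Matrix ι ι R[X]) :
    derivative B.det = (B.adjugate * B.map derivative).trace := by
  -- Cramer's rule: a diagonal entry of the product is the determinant with one column
  -- differentiated.
  have h : ∀ i, ∑ k, B.adjugate i k * derivative (B k i) =
      (B.updateCol i fun k => derivative (B k i)).det := by
    intro i
    rw [← Matrix.cramer_apply, Matrix.cramer_eq_adjugate_mulVec]
    rfl
  simp only [Matrix.trace, Matrix.diag, Matrix.mul_apply, Matrix.map_apply, h]
  simp only [Matrix.det_apply', derivative_sum]
  rw [Finset.sum_comm]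
  refine Finset.sum_congr rfl fun σ _ => ?_
  rw [derivative_mul, derivative_intCast, zero_mul, zero_add, derivative_prod_finset, Finset.mul_sum]
  refine Finset.sum_congr rfl fun i _ => ?_
  congr 1
  rw [← Finset.prod_erase_mul _ _ (Finset.mem_univ i)]
  congr 1
  · refine Finset.prod_congr rfl fun j hj => ?_
    rw [Matrix.updateCol_ne (Finset.ne_of_mem_erase hj)]
  · rw [Matrix.updateCol_self]

/-- The generating matrix `∑ n, M ^ n * X ^ n`. -/
def geometric (M : Matrix ι ι R) : Matrix ι ι (PowerSeries R) :=
  Matrix.of fun i j => PowerSeries.mk fun n => (M ^ n) i j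

theorem one_sub_mul_geometric (M : Matrix ι ι R) :
    (1 - (PowerSeries.X : PowerSeries R) • M.map (PowerSeries.C (R := R))) * geometric M = 1 := by
  rw [sub_mul, one_mul]
  ext i j n
  rw [Matrix.sub_apply, map_sub, Matrix.smul_mul, Matrix.smul_apply, smul_eq_mul]
  rcases n with _ | n
  · by_cases hij : i = j <;> simp [geometric, hij, Matrix.one_apply]
  · rw [PowerSeries.coeff_succ_X_mul, Matrix.mul_apply, map_sum]
    simp only [geometric, Matrix.of_apply, PowerSeries.coeff_mk, Matrix.map_apply,
      PowerSeries.coeff_C_mul, pow_succ', Matrix.mul_apply, sub_self]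
    by_cases hij : i = j <;> simp [Matrix.one_apply, hij, PowerSeries.coeff_one]

theorem coe_charpolyRev (M : Matrix ι ι R) : (M.charpolyRev : PowerSeries R) =
    (1 - (PowerSeries.X : PowerSeries R) • M.map (PowerSeries.C (R := R))).det := by
  rw [Matrix.charpolyRev, ← Polynomial.coeToPowerSeries.ringHom_apply, RingHom.map_det]
  congr 1
  ext1 i j
  by_cases hij : i = j <;> simp [hij] <;> exact mul_comm _ _

theorem isUnit_coe_charpolyRev (M : Matrix ι ι R) : IsUnit (M.charpolyRev : PowerSeries R) := by
  rw [PowerSeries.isUnit_iff_constantCoeff, Polynomial.constantCoeff_coe,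
    Polynomial.coeff_zero_eq_eval_zero, Matrix.eval_charpolyRev]
  exact isUnit_one

/-- Newton's identities for the traces of the powers of a matrix, in generating function form. -/
theorem charpolyRev_mul_trace (M : Matrix ι ι R) :
    (M.charpolyRev : PowerSeries R) * PowerSeries.mk (fun n => (M ^ (n + 1)).trace) =
      -((derivative M.charpolyRev : R[X]) : PowerSeries R) := by
  set B : Matrix ι ι (PowerSeries R) :=
    1 - (PowerSeries.X : PowerSeries R) • M.map (PowerSeries.C (R := R)) with hB
  -- The geometric series inverts `B`, so the adjugate is the determinant times that series.
  have hadj : B.adjugate = (M.charpolyRev : PowerSeries R) • geometric M := by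
    calc B.adjugate = B.adjugate * (B * geometric M) := by rw [one_sub_mul_geometric, mul_one]
      _ = _ := by rw [← mul_assoc, Matrix.adjugate_mul, coe_charpolyRev, Matrix.smul_mul, one_mul]
  have hmap : (1 - (X : R[X]) • M.map C).map (Polynomial.coeToPowerSeries.ringHom (R := R)) = B := by
    ext1 i j
    by_cases hij : i = j <;> simp [hij, hB] <;> exact mul_comm _ _
  have hder : (1 - (X : R[X]) • M.map C).map derivative = -M.map C := by
    ext1 i j
    by_cases hij : i = j <;> simp [hij]
  rw [Matrix.charpolyRev, derivative_det, hder, ← Matrix.charpolyRev,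
    ← Polynomial.coeToPowerSeries.ringHom_apply (φ := Matrix.trace _), Matrix.mul_neg,
    Matrix.trace_neg, map_neg, neg_neg, AddMonoidHom.map_trace,
    Matrix.map_mul, ← RingHom.mapMatrix_apply, RingHom.map_adjugate, RingHom.mapMatrix_apply, hmap,
    hadj, Matrix.smul_mul, Matrix.trace_smul, smul_eq_mul]
  congr 1
  ext n
  simp [Matrix.trace, Matrix.mul_apply, geometric, pow_succ]

/-- The traces of the positive powers of a matrix depend only on its reverse characteristic
polynomial. -/
theorem trace_pow_eq_of_charpolyRev_eq {ι' : Type*} [Fintype ι'] [DecidableEq ι']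
    {M : Matrix ι ι R} {M' : Matrix ι' ι' R} (h : M.charpolyRev = M'.charpolyRev) (n : ℕ) :
    (M ^ (n + 1)).trace = (M' ^ (n + 1)).trace := by
  have h1 := charpolyRev_mul_trace M
  rw [h, ← charpolyRev_mul_trace M', (isUnit_coe_charpolyRev M').mul_right_inj] at h1
  simpa using congrArg (PowerSeries.coeff n) h1

theorem pow_succ_apply_eq_sum_walks (M : Matrix ι ι R) (n : ℕ) (a b : ι) :
    (M ^ (n + 1)) a b = ∑ κ : Fin n → ι, ∏ i : Fin (n + 1),
      M (Fin.cons (α := fun _ => ι) a κ i) (Fin.snoc (α := fun _ => ι) κ b i) := by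
  induction n generalizing a with
  | zero => simp [Fin.snoc]
  | succ n ih =>
    rw [pow_succ', Matrix.mul_apply, ← (Fin.consEquiv fun _ : Fin (n + 1) => ι).sum_comp,
      Fintype.sum_prod_type]
    refine Finset.sum_congr rfl fun c _ => ?_
    rw [ih, Finset.mul_sum]
    refine Finset.sum_congr rfl fun κ _ => ?_
    rw [Fin.prod_univ_succ (n := n + 1)]
    change _ = M a (Fin.snoc (α := fun _ => ι) (Fin.cons (α := fun _ => ι) c κ) b 0) *
      ∏ i : Fin (n + 1), M (Fin.cons (α := fun _ => ι) c κ i)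
        (Fin.snoc (α := fun _ => ι) (Fin.cons (α := fun _ => ι) c κ) b i.succ)
    rw [← Fin.cons_snoc_eq_snoc_cons]
    rfl

/-- The trace of a power of a matrix is a sum over closed walks. -/
theorem trace_pow_succ_eq_sum_walks (M : Matrix ι ι R) (n : ℕ) :
    (M ^ (n + 1)).trace = ∑ κ : Fin (n + 1) → ι, ∏ i, M (κ i) (κ (i + 1)) := by
  rw [← (Fin.consEquiv fun _ : Fin (n + 1) => ι).sum_comp, Fintype.sum_prod_type]
  refine Finset.sum_congr rfl fun a _ => ?_
  rw [Matrix.diag_apply, pow_succ_apply_eq_sum_walks]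
  refine Finset.sum_congr rfl fun κ _ => Finset.prod_congr rfl fun i _ => ?_
  change _ = M (Fin.cons (α := fun _ => ι) a κ i) (Fin.cons (α := fun _ => ι) a κ (i + 1))
  congr 1
  induction i using Fin.lastCases with
  | last => simp
  | cast i => simp

end Trace

/-! ### The reverse characteristic polynomial of the coloring matrix. -/

section Charpoly

open Matrix Polynomial

variable {R : Type*} [CommRing R]

/-- Adding multiples of a matrix with equal rows changes the determinant affinely. -/
theorem exists_det_add_rows {ι : Type*} [Fintype ι] [DecidableEq ι] (A : Matrix ι ι R)
    (hA : IsUnit A.det) (v : ι → R) :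
    ∃ β, ∀ u : R, (A + Matrix.of fun _ j => u * v j).det = A.det + u * β := by
  refine ⟨A.det * (Matrix.replicateRow Unit v * A⁻¹ * Matrix.replicateCol Unit (fun _ : ι => (1 : R)) :
    Matrix Unit Unit R) () (), fun u => ?_⟩
  have h : (Matrix.of fun _ j => u * v j : Matrix ι ι R) =
      Matrix.replicateCol Unit (fun _ => u) * Matrix.replicateRow Unit v := by
    ext i j
    simp [Matrix.mul_apply]
  have h' : Matrix.replicateCol Unit (fun _ : ι => u) = u • Matrix.replicateCol Unit (fun _ : ι => (1 : R)) := by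
    ext i j
    simp
  rw [h, Matrix.det_add_replicateCol_mul_replicateRow hA, Matrix.det_unique (n := Unit), h',
    Matrix.mul_smul]
  simp only [Matrix.add_apply, Matrix.one_apply_eq, Matrix.smul_apply, smul_eq_mul, PUnit.default_eq_unit]
  ring

/-- The `k`-th elementary symmetric expression in the values of `x`. -/
def esymmOf {ι : Type*} [Fintype ι] (x : ι → R) (k : ℕ) : R :=
  ∑ s ∈ Finset.powersetCard k Finset.univ, ∏ i ∈ s, x i

theorem prod_one_add_mul_X {ι : Type*} [Fintype ι] (x : ι → R) (u : R) {K : ℕ}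
    (hK : Fintype.card ι ≤ K) :
    ∏ i, (1 + C (u * x i) * X) = 1 + ∑ k ∈ Finset.Icc 1 K, C (u ^ k * esymmOf x k) * X ^ k := by
  have h : ∀ k, ∑ s ∈ Finset.powersetCard k (Finset.univ : Finset ι), ∏ i ∈ s, C (u * x i) * X =
      C (u ^ k * esymmOf x k) * X ^ k := by
    intro k
    rw [esymmOf, Finset.mul_sum, map_sum, Finset.sum_mul]
    refine Finset.sum_congr rfl fun s hs => ?_
    rw [Finset.prod_mul_distrib, ← map_prod, Finset.prod_mul_distrib, Finset.prod_const,
      Finset.prod_const, (Finset.mem_powersetCard.1 hs).2]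
  rw [Finset.prod_one_add, Finset.sum_powerset]
  simp only [h]
  rw [Finset.range_eq_Ico, Finset.sum_eq_sum_Ico_succ_bot (by omega)]
  congr 1
  · simp [esymmOf]
  · refine Finset.sum_subset (fun k hk => ?_) fun k hk hk' => ?_
    · rw [Finset.mem_Ico, Finset.card_univ] at hk
      rw [Finset.mem_Icc]
      omega
    · rw [Finset.mem_Icc] at hk
      rw [Finset.mem_Ico, Finset.card_univ] at hk'
      rw [esymmOf, Finset.powersetCard_eq_empty.2 (by rw [Finset.card_univ]; omega)]
      simp

/-- The weight of a step in a coloured closed walk: `t` for an ascent, `1` for a descent, times the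
variable of the new colour. -/
def colorMatrix {ι : Type*} [LinearOrder ι] (t : R) (x : ι → R) : Matrix ι ι R :=
  Matrix.of fun i j => (if i < j then t else if j < i then 1 else 0) * x j

/-- Adding `u * X * x_j` throughout column `j` changes the determinant affinely in `u`. The choice
`u = 1` clears the entries below the diagonal and `u = t` those above it; the unknown slope cancels
between the two evaluations. Power series are used because there `det (1 - X M)` is a unit. -/
theorem charpolyRev_colorMatrix {ι : Type*} [Fintype ι] [LinearOrder ι] (t : R) (x : ι → R) :
    C (t - 1) * (colorMatrix t x).charpolyRev =
      C t * ∏ i, (1 + C (1 * x i) * X) - ∏ i, (1 + C (t * x i) * X) := by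
  apply Polynomial.coe_injective
  have hu := isUnit_coe_charpolyRev (colorMatrix t x)
  rw [coe_charpolyRev] at hu
  obtain ⟨β, hβ⟩ := exists_det_add_rows _ hu fun j => PowerSeries.X * PowerSeries.C (x j)
  have h1 := hβ 1
  have ht := hβ (PowerSeries.C t)
  rw [Matrix.det_of_isUpperTriangular] at h1
  · rw [Matrix.det_of_isLowerTriangular] at ht
    · have e1 : ∀ u : R, ((∏ i, (1 + C (u * x i) * X) : R[X]) : PowerSeries R) =
          ∏ i, (1 + PowerSeries.C u * (PowerSeries.X * PowerSeries.C (x i))) := by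
        intro u
        rw [← Polynomial.coeToPowerSeries.ringHom_apply, map_prod]
        refine Finset.prod_congr rfl fun i _ => ?_
        simp
        ring
      rw [Polynomial.coe_sub, Polynomial.coe_mul, Polynomial.coe_mul, e1, e1, coe_charpolyRev]
      simp only [Matrix.add_apply, Matrix.sub_apply, Matrix.one_apply_eq, Matrix.smul_apply,
        Matrix.map_apply, colorMatrix, Matrix.of_apply, lt_irrefl, if_false, zero_mul, map_zero,
        smul_zero, sub_zero] at h1 ht
      simp only [map_one]
      rw [h1, ht]
      simp [colorMatrix]
      ring
    · intro i j (hij : i < j)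
      simp [colorMatrix, hij, hij.ne]
      ring
  · intro i j (hij : j < i)
    simp [colorMatrix, hij, hij.ne', hij.not_gt]

end Charpoly

/-! ### The reverse characteristic polynomial of the sink automaton. -/

section Transition

open Matrix Polynomial

variable {R : Type*} [CommRing R]

/-- `∑ t ^ f` over `1 ≤ f < k`. -/
def arcWeight (t : R) (k : ℕ) : R := ∑ f ∈ Finset.Ico 1 k, t ^ f

theorem sub_one_mul_arcWeight (t : R) {k : ℕ} (hk : 1 ≤ k) :
    (t - 1) * arcWeight t k = t ^ k - t := by
  rw [arcWeight, mul_comm, geom_sum_Ico_mul _ hk, pow_one]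

/-- The transition matrix of the automaton reading the edges of a cyclic orientation. A state consists
of the number of edges read since the last sink, and the direction of the last edge. -/
def transitionMatrix (K : ℕ) (t : R) (e : ℕ → R) : Matrix (Fin K × Bool) (Fin K × Bool) R :=
  Matrix.of fun p q => if p.2 = true ∧ q.2 = false then
    if q.1.val = 0 then t * e (p.1 + 1) else 0
  else if q.1.val = p.1.val + 1 then if p.2 then t else 1 else 0

/-- The transitions that do not complete an arc. -/
def pushMatrix (K : ℕ) (t : R) : Matrix (Fin K × Bool) (Fin K × Bool) R :=
  Matrix.of fun p q => if p.2 = true ∧ q.2 = false then 0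
  else if q.1.val = p.1.val + 1 then if p.2 then t else 1 else 0

/-- Each such transition raises the first coordinate by one, so the matrix is block triangular with
identity diagonal blocks. -/
theorem det_one_sub_pushMatrix (K : ℕ) (t : R) :
    (1 - (X : R[X]) • (pushMatrix K t).map C).det = 1 := by
  have h : Matrix.BlockTriangular (1 - (X : R[X]) • (pushMatrix K t).map C) Prod.fst := by
    intro p q hqp
    have : p ≠ q := fun h => by simp [h] at hqp
    have h2 : q.1.val ≠ p.1.val + 1 := by
      have := Fin.lt_def.1 hqp
      omega
    simp [pushMatrix, this, h2]
  rw [h.det_fintype]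
  refine Finset.prod_eq_one fun k _ => ?_
  suffices h1 : (1 - (X : R[X]) • (pushMatrix K t).map C).toSquareBlock Prod.fst k = 1 by
    rw [h1, Matrix.det_one]
  ext1 p q
  obtain ⟨p, rfl⟩ := p
  obtain ⟨q, hq⟩ := q
  simp [Matrix.toSquareBlock_def, pushMatrix, hq, Matrix.one_apply]

/-- The total weight of the directions of the last `m` edges of an arc, if the first of them has
direction `b`. -/
def tailWeight (t : R) (b : Bool) (m : ℕ) : R := if b then t ^ m else arcWeight t m

theorem tailWeight_false_one (t : R) : tailWeight t false 1 = 0 := by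
  simp [tailWeight, arcWeight]

theorem tailWeight_false_succ (t : R) {m : ℕ} (hm : 1 ≤ m) :
    tailWeight t false (m + 1) = tailWeight t true m + tailWeight t false m := by
  simp only [tailWeight, arcWeight, Bool.false_eq_true, if_false, if_true]
  rw [Finset.sum_Ico_succ_top hm, add_comm]

theorem tailWeight_true_succ (t : R) (m : ℕ) :
    tailWeight t true (m + 1) = t * tailWeight t true m := by
  simp only [tailWeight, if_true]
  rw [pow_succ']

/-- The generating function of the ways to complete an arc in the state `(s, b)`. -/
def completion (K : ℕ) (t : R) (e : ℕ → R) (s : ℕ) (b : Bool) : R[X] :=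
  ∑ k ∈ Finset.Ico (s + 1) (K + 1), C (e k * tailWeight t b (k - s)) * X ^ (k - s - 1)

theorem completion_eq_zero {K : ℕ} (t : R) (e : ℕ → R) {s : ℕ} (hs : K ≤ s) (b : Bool) :
    completion K t e s b = 0 := by
  rw [completion, Finset.Ico_eq_empty (by omega), Finset.sum_empty]

theorem completion_true {K : ℕ} (t : R) (e : ℕ → R) {s : ℕ} (hs : s < K) :
    completion K t e s true = C (t * e (s + 1)) + X * (C t * completion K t e (s + 1) true) := by
  rw [completion, Finset.sum_eq_sum_Ico_succ_bot (by omega), completion, Finset.mul_sum,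
    Finset.mul_sum]
  congr 1
  · simp [tailWeight, mul_comm]
  · refine Finset.sum_congr rfl fun k hk => ?_
    rw [Finset.mem_Ico] at hk
    obtain ⟨m, rfl⟩ : ∃ m, k = s + 2 + m := ⟨k - (s + 2), by omega⟩
    rw [show s + 2 + m - s = m + 1 + 1 by omega, show s + 2 + m - (s + 1) = m + 1 by omega,
      tailWeight_true_succ]
    simp only [map_mul, Nat.add_sub_cancel]
    ring

theorem completion_false {K : ℕ} (t : R) (e : ℕ → R) {s : ℕ} (hs : s < K) :
    completion K t e s false =
      X * (completion K t e (s + 1) true + completion K t e (s + 1) false) := by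
  rw [completion, Finset.sum_eq_sum_Ico_succ_bot (by omega), completion, completion,
    ← Finset.sum_add_distrib, Finset.mul_sum, show s + 1 - s = 1 by omega, tailWeight_false_one,
    mul_zero, map_zero, zero_mul, zero_add]
  refine Finset.sum_congr rfl fun k hk => ?_
  rw [Finset.mem_Ico] at hk
  obtain ⟨m, rfl⟩ : ∃ m, k = s + 2 + m := ⟨k - (s + 2), by omega⟩
  rw [show s + 2 + m - s = m + 1 + 1 by omega, show s + 2 + m - (s + 1) = m + 1 by omega,
    tailWeight_false_succ t (by omega)]
  simp only [map_mul, map_add, Nat.add_sub_cancel]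
  ring

theorem sum_fin_ite_val_eq {A : Type*} [AddCommMonoid A] (K m : ℕ) (f : ℕ → A) :
    (∑ q : Fin K, if q.val = m then f q.val else 0) = if m < K then f m else 0 := by
  rw [Fin.sum_univ_eq_sum_range (fun q => if q = m then f q else 0) K, Finset.sum_ite_eq']
  simp

/-- First-step analysis: an arc is completed either at once, from a forward edge, or after one more
push. Hence the completion vector is `(1 - X * push)⁻¹` applied to the column of immediate
completions. -/
theorem completion_sub_push (K : ℕ) (t : R) (e : ℕ → R) (p : Fin K × Bool) :
    completion K t e p.1 p.2 -
      X * ∑ q : Fin K × Bool, C (pushMatrix K t p q) * completion K t e q.1 q.2 =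
      C (if p.2 then t * e (p.1 + 1) else 0) := by
  obtain ⟨s, b⟩ := p
  have key : ∀ c : Bool, (∑ q : Fin K, if q.val = s.val + 1 then completion K t e q.val c else 0) =
      completion K t e (s + 1) c := by
    intro c
    rw [sum_fin_ite_val_eq K (s.val + 1) fun q => completion K t e q c]
    split_ifs with h
    · rfl
    · rw [completion_eq_zero t e (by omega)]
  rw [Fintype.sum_prod_type_right, Fintype.sum_bool]
  cases b
  · simp only [pushMatrix, Matrix.of_apply, Bool.false_eq_true, false_and, if_false, apply_ite C,
      map_zero, map_one, ite_mul, zero_mul, one_mul, key]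
    rw [completion_false t e s.isLt, sub_self]
  · simp only [pushMatrix, Matrix.of_apply, and_false, and_self, if_false, if_true, apply_ite C,
      map_zero, ite_mul, zero_mul, Finset.sum_const_zero, add_zero, Bool.true_eq_false]
    simp only [← mul_ite_zero, ← Finset.mul_sum, key]
    rw [completion_true t e s.isLt]
    ring

/-- The transition matrix is the push matrix plus a rank-one matrix, since every completed arc leads
to the single state `(0, false)`. Factoring out `1 - X * push`, of determinant one, leaves `1 - X`
times the completion series of that state. -/
theorem charpolyRev_transitionMatrix (K : ℕ) (t : R) (e : ℕ → R) :
    (transitionMatrix K t e).charpolyRev =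
      1 - ∑ k ∈ Finset.Icc 1 K, C (e k * arcWeight t k) * X ^ k := by
  set v : Fin K × Bool → R[X] := fun q => if q.1.val = 0 ∧ q.2 = false then 1 else 0 with hv
  set w : Fin K × Bool → R[X] := fun q => completion K t e q.1 q.2 with hw
  have h : 1 - (X : R[X]) • (transitionMatrix K t e).map C =
      (1 - (X : R[X]) • (pushMatrix K t).map C) *
        (1 - (X : R[X]) • (Matrix.replicateCol Unit w * Matrix.replicateRow Unit v)) := by
    have h1 : (1 - (X : R[X]) • (pushMatrix K t).map C) * Matrix.replicateCol Unit w =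
        Matrix.replicateCol Unit fun p => C (if p.2 then t * e (p.1 + 1) else 0) := by
      rw [Matrix.sub_mul, Matrix.one_mul]
      ext1 p _
      rw [Matrix.sub_apply, Matrix.smul_mul, Matrix.smul_apply, Matrix.mul_apply]
      exact completion_sub_push K t e p
    rw [mul_sub, mul_one, Matrix.mul_smul, ← Matrix.mul_assoc, h1, sub_sub, ← smul_add]
    congr 2
    ext1 p q
    rw [Matrix.add_apply, Matrix.mul_apply]
    obtain ⟨s, b⟩ := p
    obtain ⟨s', b'⟩ := q
    cases b <;> cases b' <;> simp [transitionMatrix, pushMatrix, hv, apply_ite C]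
  rw [Matrix.charpolyRev, h, Matrix.det_mul, det_one_sub_pushMatrix, one_mul, ← Matrix.smul_mul,
    Matrix.det_one_sub_mul_comm, Matrix.det_unique (n := Unit), Matrix.sub_apply,
    Matrix.one_apply_eq, Matrix.mul_apply]
  congr 1
  rw [Fintype.sum_prod_type_right, Fintype.sum_bool]
  simp only [Matrix.replicateRow_apply, hv, Matrix.smul_apply, Matrix.replicateCol_apply, hw,
    Bool.true_eq_false, and_false, and_true, if_false, zero_mul, Finset.sum_const_zero, zero_add,
    ite_mul, one_mul, smul_eq_mul]
  rw [sum_fin_ite_val_eq K 0 fun q => X * completion K t e q false]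
  rcases K.eq_zero_or_pos with rfl | hK
  · simp
  · rw [if_pos hK, completion, Finset.mul_sum]
    refine Finset.sum_congr rfl fun k hk => ?_
    obtain ⟨m, rfl⟩ : ∃ m, k = m + 1 := ⟨k - 1, by have := Finset.mem_Ico.1 hk; omega⟩
    simp only [tailWeight, Bool.false_eq_true, if_false, Nat.sub_zero, Nat.add_sub_cancel]
    ring

theorem charpolyRev_colorMatrix_eq [IsDomain R] {ι : Type*} [Fintype ι] [LinearOrder ι] {t : R}
    (ht : t ≠ 1) (x : ι → R) {K : ℕ} (hK : Fintype.card ι ≤ K) :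
    (colorMatrix t x).charpolyRev = (transitionMatrix K t (esymmOf x)).charpolyRev := by
  have h0 : (C (t - 1) : R[X]) ≠ 0 := by
    rw [Ne, C_eq_zero, sub_eq_zero]
    exact ht
  apply mul_left_cancel₀ h0
  rw [charpolyRev_colorMatrix, charpolyRev_transitionMatrix, prod_one_add_mul_X x 1 hK,
    prod_one_add_mul_X x t hK, mul_sub, mul_add, mul_one, mul_one, Finset.mul_sum, Finset.mul_sum,
    add_sub_add_comm, ← Finset.sum_sub_distrib, map_sub, map_one, sub_eq_add_neg (C t - 1), ← Finset.sum_neg_distrib]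
  congr 1
  refine Finset.sum_congr rfl fun k hk => ?_
  have h := congrArg (C : R → R[X]) (sub_one_mul_arcWeight t (Finset.mem_Icc.1 hk).1)
  simp only [map_mul, map_sub, map_one, map_pow, one_pow, one_mul] at h ⊢
  linear_combination ((C (esymmOf x k) * X ^ k)) * h

end Transition

/-! ### Cyclic words, distances to the last sink, and closed walks of the automaton. -/

section Cyclic

variable {n : ℕ}

/-- Induction around the circle. -/
theorem cyclic_induction {P : Fin (n + 1) → Prop} (i₀ : Fin (n + 1)) (h₀ : P i₀)
    (h : ∀ i, P i → P (i + 1)) (i : Fin (n + 1)) : P i := by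
  have key : ∀ d : ℕ, ∀ i : Fin (n + 1), (i - i₀).val = d → P i := by
    intro d
    induction d with
    | zero =>
      intro i hi
      rwa [sub_eq_zero.1 (Fin.val_eq_zero_iff.1 hi)]
    | succ d ih =>
      intro i hi
      have hne : i - i₀ ≠ 0 := fun h0 => by simp [h0] at hi
      have := h (i - 1) (ih (i - 1) (by
        rw [sub_right_comm, Fin.val_sub_one_of_ne_zero hne, hi, Nat.add_sub_cancel]))
      rwa [sub_add_cancel] at this
  exact key _ i rfl

/-- The cyclic word `ε` of edge directions has a sink at the vertex `i`. -/
abbrev IsTurn (ε : Fin (n + 1) → Bool) (i : Fin (n + 1)) : Prop :=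
  ε (i - 1) = true ∧ ε i = false

/-- The distance from `i` back to the last sink. -/
def distToTurn (ε : Fin (n + 1) → Bool) (i : Fin (n + 1)) : ℕ :=
  sInf {d | ∃ j, IsTurn ε j ∧ (i - j).val = d}

variable {ε : Fin (n + 1) → Bool}

theorem distToTurn_le {j : Fin (n + 1)} (hj : IsTurn ε j) (i : Fin (n + 1)) :
    distToTurn ε i ≤ (i - j).val :=
  Nat.sInf_le ⟨j, hj, rfl⟩

theorem exists_sub_eq_distToTurn (h : ∃ j, IsTurn ε j) (i : Fin (n + 1)) :
    ∃ j, IsTurn ε j ∧ (i - j).val = distToTurn ε i :=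
  Nat.sInf_mem (s := {d | ∃ j, IsTurn ε j ∧ (i - j).val = d})
    (h.elim fun j hj => ⟨_, j, hj, rfl⟩)

theorem distToTurn_lt (h : ∃ j, IsTurn ε j) (i : Fin (n + 1)) : distToTurn ε i < n + 1 := by
  obtain ⟨j, -, hj⟩ := exists_sub_eq_distToTurn h i
  rw [← hj]
  exact (i - j).isLt

theorem distToTurn_eq_zero {i : Fin (n + 1)} (hi : IsTurn ε i) : distToTurn ε i = 0 := by
  simpa using distToTurn_le hi i

theorem distToTurn_succ (h : ∃ j, IsTurn ε j) {i : Fin (n + 1)} (hi : ¬IsTurn ε (i + 1)) :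
    distToTurn ε (i + 1) = distToTurn ε i + 1 := by
  have key : ∀ j, IsTurn ε j → (i + 1 - j).val = (i - j).val + 1 := by
    intro j hj
    have hne : i + 1 - j ≠ 0 := fun h0 => hi (sub_eq_zero.1 h0 ▸ hj)
    have h1 := Fin.val_sub_one_of_ne_zero hne
    rw [show i + 1 - j - 1 = i - j by abel] at h1
    have := Nat.pos_of_ne_zero fun h0 => hne (Fin.val_eq_zero_iff.1 h0)
    omega
  apply le_antisymm
  · obtain ⟨j, hj, hd⟩ := exists_sub_eq_distToTurn h i
    rw [← hd, ← key j hj]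
    exact distToTurn_le hj _
  · obtain ⟨j, hj, hd⟩ := exists_sub_eq_distToTurn h (i + 1)
    rw [← hd, key j hj]
    exact Nat.add_le_add_right (distToTurn_le hj _) 1

theorem eq_distToTurn {s : Fin (n + 1) → ℕ} (h : ∃ j, IsTurn ε j)
    (hs : ∀ i, s (i + 1) = if IsTurn ε (i + 1) then 0 else s i + 1) (i : Fin (n + 1)) :
    s i = distToTurn ε i := by
  obtain ⟨j, hj⟩ := h
  refine cyclic_induction (P := fun i => s i = distToTurn ε i) j ?_ (fun i hi => ?_) i
  · have := hs (j - 1)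
    rw [sub_add_cancel, if_pos hj] at this
    rw [this, distToTurn_eq_zero hj]
  · rw [hs]
    split_ifs with h1
    · rw [distToTurn_eq_zero h1]
    · rw [distToTurn_succ ⟨j, hj⟩ h1, hi]

/-- Without a turn `s` would grow by one at every step, contradicting that its sum is invariant
under rotation. -/
theorem exists_isTurn_of_step {s : Fin (n + 1) → ℕ}
    (hs : ∀ i, s (i + 1) = if IsTurn ε (i + 1) then 0 else s i + 1) : ∃ j, IsTurn ε j := by
  by_contra h
  rw [not_exists] at h
  have h1 : ∑ i, s (i + 1) = ∑ i, s i := Equiv.sum_comp (Equiv.addRight (1 : Fin (n + 1))) s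
  have h2 : ∑ i, s (i + 1) = ∑ i, (s i + 1) := Finset.sum_congr rfl fun i _ => by
    rw [hs, if_neg fun h' => absurd h' (h (i + 1))]
  rw [Finset.sum_add_distrib] at h2
  simp at h2
  omega

/-- The distance grows by one at each step and drops to zero at a turn; summed around the circle,
the increments balance the drops. -/
theorem sum_distToTurn_add_one (h : ∃ j, IsTurn ε j) :
    ∑ j with IsTurn ε j, (distToTurn ε (j - 1) + 1) = n + 1 := by
  have key : ∀ i, distToTurn ε i + (if IsTurn ε i then distToTurn ε (i - 1) + 1 else 0) =
      distToTurn ε (i - 1) + 1 := by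
    intro i
    split_ifs with hi
    · rw [distToTurn_eq_zero hi, zero_add]
    · have := distToTurn_succ h (i := i - 1) (by rwa [sub_add_cancel])
      rw [sub_add_cancel] at this
      rw [this, add_zero]
  have h1 := Finset.sum_congr rfl fun i (_ : i ∈ Finset.univ) => key i
  have h2 : ∑ i, distToTurn ε (i - 1) = ∑ i, distToTurn ε i :=
    Equiv.sum_comp (Equiv.subRight (1 : Fin (n + 1))) (distToTurn ε)
  rw [Finset.sum_add_distrib, Finset.sum_add_distrib, h2, ← Finset.sum_filter] at h1
  simpa using h1

/-- The weight of a cyclic word of edge directions. -/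
def turnWeight {R : Type*} [CommRing R] (t : R) (e : ℕ → R) (ε : Fin (n + 1) → Bool) : R :=
  (∏ i, if ε i then t else 1) * ∏ j with IsTurn ε j, e (distToTurn ε (j - 1) + 1)

/-- The edge directions force the counters: a factor vanishes unless the counter resets exactly at
turns and otherwise increases by one. -/
theorem prod_transitionMatrix {R : Type*} [CommRing R] {K : ℕ} (t : R) (e : ℕ → R)
    (ε : Fin (n + 1) → Bool) (s : Fin (n + 1) → Fin K) :
    ∏ i, transitionMatrix K t e (s i, ε i) (s (i + 1), ε (i + 1)) =
      if ∀ i, (s (i + 1)).val = if IsTurn ε (i + 1) then 0 else (s i).val + 1 then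
        turnWeight t e ε else 0 := by
  split_ifs with h
  · rw [turnWeight, Finset.prod_filter, ← Equiv.prod_comp (Equiv.addRight (1 : Fin (n + 1))) fun j =>
      if IsTurn ε j then e (distToTurn ε (j - 1) + 1) else 1, ← Finset.prod_mul_distrib]
    refine Finset.prod_congr rfl fun i _ => ?_
    have hi := h i
    have hd := eq_distToTurn (s := fun i => (s i).val) (exists_isTurn_of_step (s := fun i => (s i).val) h) h i
    simp only [transitionMatrix, Matrix.of_apply, Equiv.coe_addRight, IsTurn, add_sub_cancel_right]
      at hi hd ⊢
    split_ifs at hi ⊢ <;> simp_all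
  · push Not at h
    obtain ⟨i, hi⟩ := h
    refine Finset.prod_eq_zero (Finset.mem_univ i) ?_
    simp only [transitionMatrix, Matrix.of_apply, IsTurn, add_sub_cancel_right] at hi ⊢
    split_ifs at hi ⊢ <;> simp_all

theorem trace_transitionMatrix_pow {R : Type*} [CommRing R] {K : ℕ} (hK : n + 1 ≤ K) (t : R)
    (e : ℕ → R) : (transitionMatrix K t e ^ (n + 1)).trace =
      ∑ ε : Fin (n + 1) → Bool with ∃ j, IsTurn ε j, turnWeight t e ε := by
  rw [trace_pow_succ_eq_sum_walks,
    ← (Equiv.arrowProdEquivProdArrow (Fin (n + 1)) (fun _ => Fin K) fun _ => Bool).symm.sum_comp,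
    Fintype.sum_prod_type_right, Finset.sum_filter]
  refine Finset.sum_congr rfl fun ε _ => ?_
  simp only [Equiv.arrowProdEquivProdArrow, Equiv.coe_fn_symm_mk, prod_transitionMatrix]
  split_ifs with h
  -- The distance to the last turn is the only admissible counter sequence; it fits into `Fin K`
  -- because `n + 1 ≤ K`.
  · rw [Finset.sum_eq_single fun i => ⟨distToTurn ε i, (distToTurn_lt h i).trans_le hK⟩]
    · rw [if_pos]
      intro i
      split_ifs with h1
      · exact distToTurn_eq_zero h1
      · exact distToTurn_succ h h1
    · intro s _ hs
      rw [if_neg]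
      intro hs'
      exact hs (funext fun i => Fin.ext (eq_distToTurn (s := fun i => (s i).val) h hs' i))
    · simp
  · exact Finset.sum_eq_zero fun s _ =>
      if_neg fun hs => h (exists_isTurn_of_step (s := fun i => (s i).val) hs)

end Cyclic

/-! ### Gaps between consecutive sinks as distances. -/

section Sinks

variable {n : ℕ}

/-- For `i = j` the difference `j - 1 - i` is `-1`, of value `n`, so a single formula also covers
the case of one sink. -/
theorem between_bound (i j : Fin (n + 1)) :
    (if i = j then n + 1 else (j - i).val) = (j - 1 - i).val + 1 := by
  rw [sub_right_comm]
  split_ifs with h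
  · rw [h, sub_self, zero_sub, Fin.coe_neg_one]
  · have hne : j - i ≠ 0 := fun h0 => h (sub_eq_zero.1 h0).symm
    rw [Fin.val_sub_one_of_ne_zero hne]
    have := Nat.pos_of_ne_zero fun h0 => hne (Fin.val_eq_zero_iff.1 h0)
    omega

theorem mem_between {i j k : Fin (n + 1)} : k ∈ between i j ↔ 0 < k - i ∧ k - i ≤ j - 1 - i := by
  rw [between, Finset.mem_filter_univ, between_bound, Nat.lt_succ_iff]
  rfl

theorem card_between (i j : Fin (n + 1)) : (between i j).card = (j - 1 - i).val := by
  have : between i j = (Finset.Ioc 0 (j - 1 - i)).map (Equiv.addRight i).toEmbedding := by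
    ext k
    rw [mem_between, Finset.mem_map_equiv, Finset.mem_Ioc, Equiv.addRight_symm]
    simp only [Equiv.coe_addRight, sub_eq_add_neg]
  rw [this, Finset.card_map, Fin.card_Ioc]
  simp

variable {D : Digraph (Fin (n + 1))} {ε : Fin (n + 1) → Bool}

theorem consecutiveSinks_iff (hD : ∀ v, IsSink D v ↔ IsTurn ε v) (i j : Fin (n + 1)) :
    ConsecutiveSinks D i j ↔ IsTurn ε i ∧ IsTurn ε j ∧ (j - 1 - i).val = distToTurn ε (j - 1) := by
  simp only [ConsecutiveSinks, hD]
  refine and_congr_right fun hi => and_congr_right fun hj => ⟨fun h => ?_, fun h k hk hk' => ?_⟩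
  · obtain ⟨k, hk, hd⟩ := exists_sub_eq_distToTurn ⟨i, hi⟩ (j - 1)
    rw [← hd]
    refine le_antisymm (le_of_not_gt fun hlt => ?_) (hd ▸ distToTurn_le hi _)
    refine h k (mem_between.2 ?_) hk
    have e1 : k - i = (j - 1 - i) - (j - 1 - k) := by abel
    have e2 := Fin.sub_val_of_le (Fin.le_def.2 hlt.le)
    rw [← e1] at e2
    rw [Fin.lt_def, Fin.le_def, e2, Fin.val_zero]
    omega
  · rw [mem_between] at hk
    have e1 : j - 1 - k = (j - 1 - i) - (k - i) := by abel
    have e2 := Fin.sub_val_of_le hk.2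
    rw [← e1] at e2
    have := distToTurn_le hk' (j - 1)
    have h1 := Fin.lt_def.1 hk.1
    have h2 := Fin.le_def.1 hk.2
    rw [Fin.val_zero] at h1
    omega

theorem sinkGaps_eq (hD : ∀ v, IsSink D v ↔ IsTurn ε v) :
    sinkGaps D = (Finset.univ.filter fun j => IsTurn ε j).val.map fun j => distToTurn ε (j - 1) := by
  classical
  rcases isEmpty_or_nonempty {j // IsTurn ε j} with h | ⟨⟨j₀, hj₀⟩⟩
  · have h' : ∀ j, ¬IsTurn ε j := fun j hj => h.false ⟨j, hj⟩
    rw [sinkGaps, Finset.filter_false_of_mem fun p _ hp => h' _ ((consecutiveSinks_iff hD _ _).1 hp).1,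
      Finset.filter_false_of_mem fun j _ => h' j]
    rfl
  -- Each sink has exactly one predecessor, so consecutive pairs are indexed by their second entry.
  choose prev hprev hdist using fun j => exists_sub_eq_distToTurn ⟨j₀, hj₀⟩ (j - 1)
  have h : (Finset.univ.filter fun p : Fin (n + 1) × Fin (n + 1) => ConsecutiveSinks D p.1 p.2) =
      (Finset.univ.filter fun j => IsTurn ε j).map
        ⟨fun j => (prev j, j), fun a b hab => (Prod.ext_iff.1 hab).2⟩ := by
    ext ⟨i, j⟩
    simp only [Finset.mem_filter_univ, Finset.mem_map, consecutiveSinks_iff hD]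
    constructor
    · rintro ⟨-, hj, hd⟩
      rw [← hdist] at hd
      exact ⟨j, hj, Prod.ext (sub_right_injective (Fin.ext hd)).symm rfl⟩
    · rintro ⟨j, hj, ⟨⟩⟩
      exact ⟨hprev _, hj, hdist _⟩
  rw [sinkGaps, h, Finset.map_val, Multiset.map_map]
  refine Multiset.map_congr rfl fun j _ => ?_
  exact (card_between _ _).trans (hdist j)

end Sinks

/-! ### Acyclic orientations as cyclic words with a sink. -/

section Orientation

variable {n : ℕ}

theorem directedCycle_adj (u v : Fin (n + 1)) : (directedCycle (n + 1)).Adj u v ↔ v = u + 1 := by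
  change (u.val + 1 = v.val ∨ (u.val + 1 = n + 1 ∧ v.val = 0)) ↔ _
  rw [Fin.ext_iff, Fin.val_add_one]
  have := v.isLt
  split_ifs with h
  · have : u.val = n := by rw [h]; rfl
    omega
  · have : u.val ≠ n := fun h' => h (Fin.ext h')
    omega

theorem underlying_adj (u v : Fin (n + 2)) :
    (underlying (directedCycle (n + 2))).Adj u v ↔ v = u + 1 ∨ u = v + 1 := by
  rw [underlying, Digraph.toSimpleGraphInclusive, SimpleGraph.fromRel_adj, directedCycle_adj,
    directedCycle_adj]
  refine and_iff_right_of_imp fun h huv => ?_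
  subst huv
  simp at h

/-- The orientation of the cycle in which the edge from `i` to `i + 1` is oriented according to
`ε i`. -/
def orientation (ε : Fin (n + 1) → Bool) : Digraph (Fin (n + 1)) where
  Adj u v := (v = u + 1 ∧ ε u = true) ∨ (u = v + 1 ∧ ε v = false)

variable {ε : Fin (n + 1) → Bool}

theorem orientation_adj {u v : Fin (n + 1)} : (orientation ε).Adj u v ↔
    (v = u + 1 ∧ ε u = true) ∨ (u = v + 1 ∧ ε v = false) := Iff.rfl

theorem isSink_orientation (v : Fin (n + 1)) : IsSink (orientation ε) v ↔ IsTurn ε v := by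
  refine ⟨fun h => ⟨?_, ?_⟩, fun h w hw => ?_⟩
  · by_contra h'
    exact h (v - 1) (.inr ⟨(sub_add_cancel _ _).symm, by simpa using h'⟩)
  · by_contra h'
    exact h (v + 1) (.inl ⟨rfl, by simpa using h'⟩)
  · rcases hw with ⟨-, h'⟩ | ⟨rfl, h'⟩
    · simp [h.2] at h'
    · have := h.1
      rw [add_sub_cancel_right] at this
      simp [h'] at this

/-- If the circle has only the vertices `u` and `v`, the two edges between them get different
directions. -/
theorem eq_not_of_two_cycle (h : ∃ j, IsTurn ε j) {u v : Fin (n + 1)} (huv : v = u + 1)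
    (hvu : u = v + 1) : ε v = !ε u := by
  have key : ∀ i, i = u ∨ i = v := cyclic_induction u (.inl rfl) fun i hi => by
    rcases hi with rfl | rfl
    · exact .inr huv.symm
    · exact .inl hvu.symm
  obtain ⟨j, hj⟩ := h
  have hu : u - 1 = v := by rw [hvu, add_sub_cancel_right]
  have hv : v - 1 = u := by rw [huv, add_sub_cancel_right]
  rcases key j with rfl | rfl
  · rw [IsTurn, hu] at hj
    simp [hj.1, hj.2]
  · rw [IsTurn, hv] at hj
    simp [hj.1, hj.2]

theorem orientation_adj_succ (h : ∃ j, IsTurn ε j) (i : Fin (n + 1)) :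
    (orientation ε).Adj i (i + 1) ↔ ε i = true := by
  refine ⟨fun h' => ?_, fun h' => .inl ⟨rfl, h'⟩⟩
  rcases h' with ⟨-, h'⟩ | ⟨hi, h'⟩
  · exact h'
  · simpa [h'] using eq_not_of_two_cycle h rfl hi

theorem orientation_antisymm (h : ∃ j, IsTurn ε j) (u v : Fin (n + 1))
    (huv : (orientation ε).Adj u v) : ¬(orientation ε).Adj v u := by
  rintro (⟨h3, h4⟩ | ⟨h3, h4⟩) <;> rcases huv with ⟨h1, h2⟩ | ⟨h1, h2⟩
  · simpa [h2, h4] using eq_not_of_two_cycle h h1 h3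
  · simp [h2] at h4
  · simp [h2] at h4
  · simpa [h2, h4] using eq_not_of_two_cycle h h3 h1

/-- A potential that increases along every oriented edge, if `j` is a sink. -/
def potential (ε : Fin (n + 1) → Bool) (j v : Fin (n + 1)) : ℤ :=
  if v = j then n + 2 else ∑ i with i - j < v - j, if ε i then 1 else -1

theorem potential_le {j v : Fin (n + 1)} (h : v ≠ j) : potential ε j v ≤ n + 1 := by
  rw [potential, if_neg h]
  refine (Finset.sum_le_card_nsmul _ _ 1 fun i _ => by split_ifs <;> simp).trans ?_
  have := Finset.card_le_univ (Finset.univ.filter fun i => i - j < v - j)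
  rw [Fintype.card_fin] at this
  simp
  exact_mod_cast this

theorem potential_succ {j v : Fin (n + 1)} (h : v ≠ j) (h' : v + 1 ≠ j) :
    potential ε j (v + 1) = (if ε v then 1 else -1) + potential ε j v := by
  rw [potential, potential, if_neg h, if_neg h', ← Finset.sum_insert (s := Finset.univ.filter _)
    (f := fun i => if ε i then (1 : ℤ) else -1) (by simp)]
  congr 1
  ext i
  rw [Finset.mem_insert, Finset.mem_filter_univ, Finset.mem_filter_univ]
  have hne : v + 1 - j ≠ 0 := fun h0 => h' (sub_eq_zero.1 h0)
  have h1 := Fin.val_sub_one_of_ne_zero hne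
  rw [show v + 1 - j - 1 = v - j by abel] at h1
  have := Nat.pos_of_ne_zero fun h0 => hne (Fin.val_eq_zero_iff.1 h0)
  have h2 : i = v ↔ (i - j).val = (v - j).val := by rw [← Fin.ext_iff, sub_left_inj]
  rw [Fin.lt_def, Fin.lt_def, h2]
  omega

/-- Cut the circle at the sink `j` and let the height go up along forward edges and down along
backward ones. The value `n + 2` at `j` exceeds all other heights, so the edges into `j` also go up.
-/
theorem potential_lt {j u v : Fin (n + 1)} (hj : IsTurn ε j) (h : (orientation ε).Adj u v) :
    potential ε j u < potential ε j v := by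
  have hu : u ≠ j := by
    rintro rfl
    exact (isSink_orientation _).2 hj v h
  by_cases hv : v = j
  · have := potential_le (ε := ε) hu
    rw [potential.eq_def ε j v, if_pos hv]
    omega
  · rcases h with ⟨rfl, h⟩ | ⟨rfl, h⟩
    · rw [potential_succ hu hv, h]
      simp
    · rw [potential_succ hv hu, h]
      simp

theorem isAcyclicOrientation_orientation {ε : Fin (n + 2) → Bool} (h : ∃ j, IsTurn ε j) :
    IsAcyclicOrientation (underlying (directedCycle (n + 2))) (orientation ε) where
  adj_iff u v := by
    rw [underlying_adj]
    constructor
    · rintro (h | h)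
      · cases hu : ε u
        · exact .inr (.inr ⟨h, hu⟩)
        · exact .inl (.inl ⟨h, hu⟩)
      · cases hv : ε v
        · exact .inl (.inr ⟨h, hv⟩)
        · exact .inr (.inl ⟨h, hv⟩)
    · rintro ((⟨h, -⟩ | ⟨h, -⟩) | (⟨h, -⟩ | ⟨h, -⟩)) <;> simp [h]
  antisymm := orientation_antisymm h
  acyclic v hv := by
    obtain ⟨j, hj⟩ := h
    have : ∀ w, Relation.TransGen (orientation ε).Adj v w → potential ε j v < potential ε j w := by
      intro w hw
      induction hw with
      | single h => exact potential_lt hj h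
      | tail _ h ih => exact ih.trans (potential_lt hj h)
    exact lt_irrefl _ (this v hv)

theorem exists_eq_orientation {D : Digraph (Fin (n + 2))}
    (hD : IsAcyclicOrientation (underlying (directedCycle (n + 2))) D) :
    ∃ ε : Fin (n + 2) → Bool, (∃ j, IsTurn ε j) ∧ orientation ε = D := by
  classical
  set ε : Fin (n + 2) → Bool := fun i => decide (D.Adj i (i + 1)) with hε
  have hεD : orientation ε = D := by
    ext u v
    rw [orientation_adj]
    simp only [hε, decide_eq_true_eq, decide_eq_false_iff_not]
    have h1 := hD.adj_iff u v
    rw [underlying_adj] at h1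
    constructor
    · rintro (⟨rfl, h⟩ | ⟨rfl, h⟩)
      · exact h
      · exact (h1.1 (.inr rfl)).resolve_right h
    · intro h
      rcases h1.2 (.inl h) with rfl | rfl
      · exact .inl ⟨rfl, h⟩
      · exact .inr ⟨rfl, hD.antisymm _ _ h⟩
  refine ⟨ε, ?_, hεD⟩
  -- A word without a turn is constant, and a constant word is a directed closed walk around the
  -- circle.
  by_contra hno
  rw [not_exists] at hno
  by_cases h0 : ∃ i₀, ε i₀ = true
  · obtain ⟨i₀, h0⟩ := h0
    have hall := cyclic_induction (P := fun i => ε i = true) i₀ h0 fun i hi => by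
      by_contra h'
      exact hno (i + 1) ⟨by rwa [add_sub_cancel_right], by simpa using h'⟩
    have hadj : ∀ i, D.Adj i (i + 1) := fun i => hεD ▸ .inl ⟨rfl, hall i⟩
    have hreach := cyclic_induction (P := Relation.ReflTransGen D.Adj 0) 0 .refl
      fun i hi => hi.tail (hadj i)
    have := Relation.TransGen.tail' (hreach (-1)) (hadj (-1))
    rw [neg_add_cancel] at this
    exact hD.acyclic 0 this
  · have hall : ∀ i, ε i = false := by simpa using h0
    have hadj : ∀ i, D.Adj (i + 1) i := fun i => hεD ▸ .inr ⟨rfl, hall i⟩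
    have hreach := cyclic_induction (P := fun i => Relation.ReflTransGen D.Adj i 0) 0 .refl
      fun i hi => hi.head (hadj i)
    have h1 := hadj (-1)
    rw [neg_add_cancel] at h1
    exact hD.acyclic 0 (Relation.TransGen.head' h1 (hreach (-1)))

/-- The restriction to words with a turn matters on two vertices: there both constant words give the
digraph with both directions. -/
theorem orientation_injOn : Set.InjOn (orientation (n := n)) {ε | ∃ j, IsTurn ε j} := by
  intro ε h ε' h' heq
  ext1 i
  rw [Bool.eq_iff_iff, ← orientation_adj_succ h, ← orientation_adj_succ h', heq]

theorem orientationAsc_orientation (h : ∃ j, IsTurn ε j) :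
    orientationAsc (directedCycle (n + 1)) (orientation ε) =
      (Finset.univ.filter fun i => ε i = true).card := by
  have : {p : Fin (n + 1) × Fin (n + 1) | (directedCycle (n + 1)).Adj p.1 p.2 ∧
      (orientation ε).Adj p.1 p.2} = (fun i => (i, i + 1)) '' {i | ε i = true} := by
    ext ⟨u, v⟩
    simp only [Set.mem_ofPred_eq, directedCycle_adj, Set.mem_image, Prod.mk.injEq]
    constructor
    · rintro ⟨rfl, h'⟩
      exact ⟨u, (orientation_adj_succ h u).1 h', rfl, rfl⟩
    · rintro ⟨i, hi, rfl, rfl⟩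
      exact ⟨rfl, (orientation_adj_succ h i).2 hi⟩
  rw [orientationAsc, this, Set.ncard_image_of_injective _ fun a b hab => (Prod.ext_iff.1 hab).1,
    ← Set.ncard_coe_finset]
  simp

theorem exists_partition_of_isTurn (h : ∃ j, IsTurn ε j) :
    ∃ lam : (n + 1).Partition, lam.parts =
      (Finset.univ.filter fun j => IsTurn ε j).val.map fun j => distToTurn ε (j - 1) + 1 := by
  refine ⟨⟨_, fun hi => ?_, sum_distToTurn_add_one h⟩, rfl⟩
  obtain ⟨j, -, rfl⟩ := Multiset.mem_map.1 hi
  exact Nat.succ_pos _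

theorem sinkGaps_orientation_eq_iff (lam : (n + 1).Partition) :
    sinkGaps (orientation ε) = lam.parts.map (fun a => a - 1) ↔ lam.parts =
      (Finset.univ.filter fun j => IsTurn ε j).val.map fun j => distToTurn ε (j - 1) + 1 := by
  rw [sinkGaps_eq isSink_orientation]
  constructor
  · intro h
    have h1 := congrArg (Multiset.map (· + 1)) h
    rw [Multiset.map_map, Multiset.map_map] at h1
    rw [← Function.comp_def (· + 1), h1]
    conv_lhs => rw [← Multiset.map_id lam.parts]
    refine Multiset.map_congr rfl fun a ha => ?_
    exact (Nat.succ_pred_eq_of_pos (lam.parts_pos ha)).symm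
  · intro h
    rw [h, Multiset.map_map]
    rfl

/-- The sum over all acyclic orientations, sorted by their sink gaps, in terms of cyclic words. -/
theorem sum_acyclicOrientations {A : Type*} [CommRing A] (t : A) (e : ℕ → A) :
    ∑ lam : (n + 2).Partition, (∑ D ∈ acyclicOrientations lam,
      t ^ orientationAsc (directedCycle (n + 2)) D) * (lam.parts.map e).prod =
    ∑ ε : Fin (n + 2) → Bool with ∃ j, IsTurn ε j, turnWeight t e ε := by
  classical
  have key : ∀ lam : (n + 2).Partition, (∑ D ∈ acyclicOrientations lam,
      t ^ orientationAsc (directedCycle (n + 2)) D) * (lam.parts.map e).prod =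
      ∑ ε : Fin (n + 2) → Bool with ∃ j, IsTurn ε j,
        if sinkGaps (orientation ε) = lam.parts.map (fun a => a - 1) then turnWeight t e ε else 0 := by
    intro lam
    rw [← Finset.sum_filter, Finset.filter_filter, Finset.sum_mul]
    symm
    refine Finset.sum_bij (fun ε _ => orientation ε) ?_ ?_ ?_ ?_
    · intro ε hε
      rw [Finset.mem_filter_univ] at hε
      rw [acyclicOrientations, Finset.mem_filter_univ]
      exact ⟨isAcyclicOrientation_orientation hε.1, hε.2⟩
    · intro ε hε ε' hε' heq
      rw [Finset.mem_filter_univ] at hε hε'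
      exact orientation_injOn hε.1 hε'.1 heq
    · intro D hD
      rw [acyclicOrientations, Finset.mem_filter_univ] at hD
      obtain ⟨ε, hε, rfl⟩ := exists_eq_orientation hD.1
      exact ⟨ε, by rw [Finset.mem_filter_univ]; exact ⟨hε, hD.2⟩, rfl⟩
    · intro ε hε
      rw [Finset.mem_filter_univ] at hε
      rw [orientationAsc_orientation hε.1, (sinkGaps_orientation_eq_iff lam).1 hε.2,
        Multiset.map_map, turnWeight, Finset.prod_ite]
      simp
      rfl
  -- After the exchange of sums, each word contributes to exactly one partition, that of its arc
  -- lengths.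
  rw [Finset.sum_congr rfl fun lam _ => key lam, Finset.sum_comm]
  refine Finset.sum_congr rfl fun ε hε => ?_
  rw [Finset.mem_filter_univ] at hε
  obtain ⟨lam, hlam⟩ := exists_partition_of_isTurn hε
  rw [Finset.sum_eq_single lam, if_pos ((sinkGaps_orientation_eq_iff lam).2 hlam)]
  · intro lam' _ hne
    rw [if_neg fun h => hne (Nat.Partition.ext (((sinkGaps_orientation_eq_iff lam').1 h).trans hlam.symm))]
  · simp

end Orientation

/-! ### Reduction to finitely many variables. -/

section Restriction

/-- Setting all variables outside of `s` to zero. -/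
abbrev restrict (s : Finset ℕ+) : MvPowerSeries ℕ+ ℚ[X] →ₐ[ℚ[X]] MvPowerSeries s ℚ[X] :=
  MvPowerSeries.killCompl (Function.Embedding.subtype (· ∈ s))

/-- The coefficient of a monomial survives restriction to the support of that monomial. -/
theorem eq_of_restrict_eq {f g : MvPowerSeries ℕ+ ℚ[X]} (h : ∀ s, restrict s f = restrict s g) :
    f = g := by
  ext1 m
  obtain ⟨x, hx⟩ : m ∈ Set.range (Finsupp.embDomain (M := ℕ)
      (Function.Embedding.subtype (· ∈ m.support))) := by
    rw [Finsupp.mem_range_embDomain_iff]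
    exact fun i hi => ⟨⟨i, hi⟩, rfl⟩
  have := congrArg (MvPowerSeries.coeff x) (h m.support)
  rwa [MvPowerSeries.coeff_killCompl, MvPowerSeries.coeff_killCompl, hx] at this

theorem le_one_and_degree_iff {σ : Type*} [Fintype σ] (x : σ →₀ ℕ) (k : ℕ) :
    ((∀ i, x i ≤ 1) ∧ x.degree = k) ↔
      ∃ T ∈ Finset.powersetCard k (Finset.univ : Finset σ), ∑ i ∈ T, Finsupp.single i 1 = x := by
  classical
  constructor
  · rintro ⟨h1, rfl⟩
    have h : ∀ i ∈ x.support, x i = 1 := fun i hi =>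
      le_antisymm (h1 i) (Nat.pos_of_ne_zero (Finsupp.mem_support_iff.1 hi))
    refine ⟨x.support, Finset.mem_powersetCard.2 ⟨Finset.subset_univ _, ?_⟩, ?_⟩
    · rw [Finsupp.degree_apply, Finset.sum_congr rfl h]
      simp
    · conv_rhs => rw [← Finsupp.sum_single x, Finsupp.sum]
      exact Finset.sum_congr rfl fun i hi => by rw [h i hi]
  · rintro ⟨T, hT, rfl⟩
    refine ⟨fun i => ?_, ?_⟩
    · simp only [Finsupp.finsetSum_apply, Finsupp.single_apply, Finset.sum_ite_eq']
      split_ifs <;> simp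
    · rw [map_sum]
      simp [(Finset.mem_powersetCard.1 hT).2]

theorem sum_single_injective {σ : Type*} :
    Function.Injective fun T : Finset σ => ∑ i ∈ T, Finsupp.single i 1 := by
  classical
  intro S T h
  ext i
  have := DFunLike.congr_fun h i
  simp only [Finsupp.finsetSum_apply, Finsupp.single_apply, Finset.sum_ite_eq'] at this
  split_ifs at this <;> simp_all

theorem restrict_elementary (s : Finset ℕ+) (k : ℕ) :
    restrict s (elementary k) = (MvPolynomial.esymm s ℚ[X] k : MvPowerSeries s ℚ[X]) := by
  classical
  ext1 x
  rw [MvPowerSeries.coeff_killCompl, MvPolynomial.coeff_coe, MvPolynomial.esymm_eq_sum_monomial,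
    MvPolynomial.coeff_sum]
  simp only [MvPolynomial.coeff_monomial]
  have h1 : ((∀ i, Finsupp.embDomain (Function.Embedding.subtype (· ∈ s)) x i ≤ 1) ∧
      (Finsupp.embDomain (Function.Embedding.subtype (· ∈ s)) x).degree = k) ↔
      ((∀ i, x i ≤ 1) ∧ x.degree = k) := by
    refine and_congr ⟨fun h i => ?_, fun h i => ?_⟩ ?_
    · rw [← Finsupp.embDomain_apply_self (Function.Embedding.subtype (· ∈ s)) x i]
      exact h _
    · by_cases hi : i ∈ Set.range (Function.Embedding.subtype (· ∈ s))
      · obtain ⟨i, rfl⟩ := hi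
        rw [Finsupp.embDomain_apply_self]
        exact h i
      · rw [Finsupp.embDomain_of_notMem_range _ _ _ hi]
        exact zero_le_one
    · rw [Finsupp.degree_apply, Finsupp.degree_apply, Finsupp.support_embDomain, Finset.sum_map]
      simp only [Finsupp.embDomain_apply_self]
  change (if _ then (1 : ℚ[X]) else 0) = _
  rw [if_congr (h1.trans (le_one_and_degree_iff x k)) rfl rfl]
  split_ifs with h
  · obtain ⟨T, hT, rfl⟩ := h
    rw [Finset.sum_eq_single_of_mem T hT fun S _ hne => if_neg fun h => hne (sum_single_injective h),
      if_pos rfl]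
  · exact (Finset.sum_eq_zero fun T hT => if_neg fun hx => h ⟨T, hT, hx⟩).symm

theorem restrict_elementaryPart (s : Finset ℕ+) {n : ℕ} (lam : n.Partition) :
    restrict s (elementaryPart lam) =
      ((lam.parts.map (MvPolynomial.esymm s ℚ[X])).prod : MvPolynomial s ℚ[X]) := by
  rw [elementaryPart, map_multiset_prod, Multiset.map_map,
    ← MvPolynomial.coeToMvPowerSeries.ringHom_apply, map_multiset_prod, Multiset.map_map]
  congr 1
  exact Multiset.map_congr rfl fun k _ => restrict_elementary s k

theorem restrict_sum (s : Finset ℕ+) {n : ℕ} (c : n.Partition → ℚ[X]) :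
    restrict s (∑ lam : n.Partition, c lam • elementaryPart lam) =
      ((∑ lam : n.Partition, MvPolynomial.C (c lam) *
        (lam.parts.map (MvPolynomial.esymm s ℚ[X])).prod : MvPolynomial s ℚ[X]) :
          MvPowerSeries s ℚ[X]) := by
  rw [map_sum, ← MvPolynomial.coeToMvPowerSeries.ringHom_apply, map_sum]
  refine Finset.sum_congr rfl fun lam _ => ?_
  rw [map_smul, restrict_elementaryPart, ← MvPolynomial.smul_eq_C_mul,
    MvPolynomial.coeToMvPowerSeries.ringHom_apply, MvPolynomial.coe_smul]

end Restriction

/-! ### Linear independence of the elementary products. -/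

section Independence

theorem monomial_toFinsupp {σ R : Type*} [CommSemiring R] [DecidableEq σ] (M : Multiset σ) :
    MvPolynomial.monomial (R := R) (Multiset.toFinsupp M) 1 = (M.map MvPolynomial.X).prod := by
  induction M using Multiset.induction with
  | empty => simp
  | cons a M ih =>
    rw [Multiset.map_cons, Multiset.prod_cons, ← ih, ← Multiset.singleton_add, map_add,
      Multiset.toFinsupp_singleton, MvPolynomial.X, MvPolynomial.monomial_mul, one_mul]

/-- The products of elementary symmetric polynomials indexed by the partitions of `n` are linearly
independent if there are at least `n` variables. -/
theorem eq_zero_of_sum_esymm_eq_zero {σ R : Type*} [Fintype σ] [CommRing R] {n : ℕ}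
    (hn : n + 1 ≤ Fintype.card σ) (c : (n + 1).Partition → R)
    (h : ∑ lam : (n + 1).Partition, MvPolynomial.C (c lam) *
      (lam.parts.map (MvPolynomial.esymm σ R)).prod = 0) (lam : (n + 1).Partition) : c lam = 0 := by
  classical
  -- The variable `i` maps to `e_(i+1)` under `esymmAlgHom`, hence the shift. Parts lie between `1`
  -- and `n + 1`, so the reduction modulo `n + 1` is harmless.
  set g : ℕ → Fin (n + 1) := fun a => Fin.ofNat (n + 1) (a - 1) with hg
  have hval : ∀ lam : (n + 1).Partition, ∀ a ∈ lam.parts, (g a).val + 1 = a := by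
    intro lam a ha
    have h1 := lam.parts_pos ha
    have h2 := lam.le_of_mem_parts ha
    rw [hg, Fin.val_ofNat, Nat.mod_eq_of_lt (by omega)]
    omega
  set m : (n + 1).Partition → Fin (n + 1) →₀ ℕ := fun lam => Multiset.toFinsupp (lam.parts.map g)
    with hm
  have hinj : Function.Injective m := by
    intro lam mu heq
    have h1 := congrArg (Multiset.map fun i => i.val + 1) (Multiset.toFinsupp.injective heq)
    rw [Multiset.map_map, Multiset.map_map] at h1
    have h2 : ∀ lam : (n + 1).Partition,
        lam.parts.map ((fun i : Fin (n + 1) => i.val + 1) ∘ g) = lam.parts := fun lam =>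
      (Multiset.map_congr rfl (hval lam)).trans (Multiset.map_id' _)
    rw [h2, h2] at h1
    exact Nat.Partition.ext h1
  have hsum : ∑ lam, MvPolynomial.monomial (m lam) (c lam) = 0 := by
    apply MvPolynomial.esymmAlgHom_injective R hn
    rw [map_zero]
    apply Subtype.ext
    rw [MvPolynomial.esymmAlgHom_apply, map_sum]
    refine (Finset.sum_congr rfl fun lam _ => ?_).trans h
    rw [← mul_one (c lam), ← MvPolynomial.C_mul_monomial, map_mul, MvPolynomial.aeval_C, hm,
      monomial_toFinsupp, map_multiset_prod, Multiset.map_map, Multiset.map_map, mul_one,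
      MvPolynomial.algebraMap_eq]
    congr 2
    refine Multiset.map_congr rfl fun a ha => ?_
    simp [hval lam a ha]
  have := congrArg (MvPolynomial.coeff (m lam)) hsum
  simpa [MvPolynomial.coeff_sum, MvPolynomial.coeff_monomial, hinj.eq_iff] using this

theorem elementaryPart_independent {n : ℕ} (c c' : (n + 1).Partition → ℚ[X])
    (h : ∑ lam, c lam • elementaryPart lam = ∑ lam, c' lam • elementaryPart lam) : c = c' := by
  obtain ⟨s, hs⟩ := Infinite.exists_subset_card_eq ℕ+ (n + 1)
  have h1 := congrArg (restrict s) h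
  rw [restrict_sum, restrict_sum, MvPolynomial.coe_inj] at h1
  ext1 lam
  rw [← sub_eq_zero]
  refine eq_zero_of_sum_esymm_eq_zero (σ := s) (by simp [hs]) (fun lam => c lam - c' lam) ?_ lam
  simp only [map_sub, sub_mul, Finset.sum_sub_distrib]
  rw [h1, sub_self]

end Independence

/-! ### The chromatic function as a trace, and the comparison. -/

section Coloring

variable {n : ℕ}

theorem prod_colorMatrix {ι : Type*} [LinearOrder ι] (κ : Fin (n + 1) → ι) :
    ∏ i, colorMatrix (MvPolynomial.C (Polynomial.X : ℚ[X])) (MvPolynomial.X (σ := ι)) (κ i) (κ (i + 1)) =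
      if ∀ i, κ i ≠ κ (i + 1) then MvPolynomial.monomial (∑ i, Finsupp.single (κ i) 1)
        ((Polynomial.X : ℚ[X]) ^ (Finset.univ.filter fun i => κ i < κ (i + 1)).card) else 0 := by
  split_ifs with h
  · have h1 : ∀ i, colorMatrix (MvPolynomial.C (Polynomial.X : ℚ[X])) (MvPolynomial.X (σ := ι))
        (κ i) (κ (i + 1)) = MvPolynomial.C (if κ i < κ (i + 1) then Polynomial.X else 1) *
          MvPolynomial.X (κ (i + 1)) := by
      intro i
      rw [colorMatrix, Matrix.of_apply]
      rcases lt_or_gt_of_ne (h i) with hi | hi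
      · simp [hi]
      · simp [hi, hi.not_gt]
    rw [Finset.prod_congr rfl fun i _ => h1 i, Finset.prod_mul_distrib, ← map_prod,
      ← mul_one (Polynomial.X ^ _), ← MvPolynomial.C_mul_monomial, MvPolynomial.monomial_sum_one]
    congr 1
    · rw [Finset.prod_ite]
      simp
    -- Each step carries the variable of its endpoint; a rotation gives every vertex its own
    -- variable.
    · exact Equiv.prod_comp (Equiv.addRight (1 : Fin (n + 1)))
        fun i => (MvPolynomial.X (κ i) : MvPolynomial ι ℚ[X])
  · push Not at h
    obtain ⟨i, hi⟩ := h
    refine Finset.prod_eq_zero (Finset.mem_univ i) ?_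
    simp [colorMatrix, hi]

theorem colorAsc_directedCycle (κ : ProperColoring (directedCycle (n + 1))) :
    colorAsc (directedCycle (n + 1)) κ = (Finset.univ.filter fun i => κ i < κ (i + 1)).card := by
  have : {p : Fin (n + 1) × Fin (n + 1) | (directedCycle (n + 1)).Adj p.1 p.2 ∧ κ p.1 < κ p.2} =
      (fun i => (i, i + 1)) '' {i | κ i < κ (i + 1)} := by
    ext ⟨u, v⟩
    simp only [Set.mem_ofPred_eq, directedCycle_adj, Set.mem_image, Prod.mk.injEq]
    constructor
    · rintro ⟨rfl, h'⟩
      exact ⟨u, h', rfl, rfl⟩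
    · rintro ⟨i, hi, rfl, rfl⟩
      exact ⟨rfl, hi⟩
  rw [colorAsc, this, Set.ncard_image_of_injective _ fun a b hab => (Prod.ext_iff.1 hab).1,
    ← Set.ncard_coe_finset]
  simp

theorem restrict_chromaticQuasisymmetric (s : Finset ℕ+) :
    restrict s (chromaticQuasisymmetric (directedCycle (n + 2))) =
      ((colorMatrix (MvPolynomial.C (Polynomial.X : ℚ[X])) (MvPolynomial.X (σ := s)) ^ (n + 2)).trace :
        MvPolynomial s ℚ[X]) := by
  classical
  ext1 x
  rw [MvPowerSeries.coeff_killCompl, MvPolynomial.coeff_coe, trace_pow_succ_eq_sum_walks,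
    MvPolynomial.coeff_sum]
  simp only [prod_colorMatrix, apply_ite (MvPolynomial.coeff x), MvPolynomial.coeff_monomial,
    MvPolynomial.coeff_zero]
  simp only [← ite_and]
  refine Eq.trans ?_ (Finset.sum_filter (fun κ : Fin (n + 2) → s =>
    (∀ i, κ i ≠ κ (i + 1)) ∧ ∑ i, Finsupp.single (κ i) 1 = x) _)
  have hvalid : ∀ κ : Fin (n + 2) → s, (∀ i, κ i ≠ κ (i + 1)) →
      ∀ {u v}, (underlying (directedCycle (n + 2))).Adj u v → (κ u : ℕ+) ≠ κ v := by
    intro κ hκ u v huv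
    rw [Subtype.coe_ne_coe]
    rcases (underlying_adj u v).1 huv with rfl | rfl
    · exact hκ u
    · exact (hκ v).symm
  have hweight : ∀ κ : Fin (n + 2) → s, ∑ i, Finsupp.single (κ i : ℕ+) 1 =
      Finsupp.embDomain (Function.Embedding.subtype (· ∈ s)) (∑ i, Finsupp.single (κ i) 1) := by
    intro κ
    rw [Finsupp.embDomain_eq_mapDomain, Finsupp.mapDomain_finsetSum]
    simp only [Finsupp.mapDomain_single]
    rfl
  refine (finsum_mem_eq_finite_toFinset_sum _ (finite_colorWeight_eq _ _)).trans ?_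
  symm
  refine Finset.sum_bij (fun κ hκ => SimpleGraph.Coloring.mk (fun v => (κ v : ℕ+))
    (hvalid κ (Finset.mem_filter.1 hκ).2.1)) ?_ ?_ ?_ ?_
  · intro κ hκ
    rw [Set.Finite.mem_toFinset]
    exact (hweight κ).trans (congrArg _ (Finset.mem_filter.1 hκ).2.2)
  · intro κ _ κ' _ heq
    ext1 v
    exact Subtype.ext (DFunLike.congr_fun heq v)
  · intro κ hκ
    rw [Set.Finite.mem_toFinset] at hκ
    change colorWeight _ κ = _ at hκ
    have hmem : ∀ v, κ v ∈ s := by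
      intro v
      by_contra hv
      have h0 := Finsupp.embDomain_of_notMem_range (Function.Embedding.subtype (· ∈ s)) x (κ v) (by
        rintro ⟨i, hi⟩
        exact hv (hi ▸ i.2))
      rw [← hκ, colorWeight, Finsupp.finsetSum_apply, Finset.sum_eq_zero_iff] at h0
      simpa using h0 v (Finset.mem_univ v)
    refine ⟨fun v => ⟨κ v, hmem v⟩, Finset.mem_filter.2 ⟨Finset.mem_univ _, fun i hi => ?_, ?_⟩, ?_⟩
    · exact κ.valid ((underlying_adj i (i + 1)).2 (.inl rfl)) (Subtype.ext_iff.1 hi)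
    · exact Finsupp.embDomain_injective _ ((hweight _).symm.trans hκ)
    · ext1 v
      rfl
  · intro κ hκ
    rw [colorAsc_directedCycle]
    rfl

theorem chromaticQuasisymmetric_directedCycle :
    chromaticQuasisymmetric (directedCycle (n + 2)) = ∑ lam : (n + 2).Partition,
      (∑ D ∈ acyclicOrientations lam,
        (Polynomial.X : ℚ[X]) ^ orientationAsc (directedCycle (n + 2)) D) • elementaryPart lam := by
  refine eq_of_restrict_eq fun s => ?_
  have hX : (MvPolynomial.C (Polynomial.X : ℚ[X]) : MvPolynomial s ℚ[X]) ≠ 1 := by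
    rw [← MvPolynomial.C_1, (MvPolynomial.C_injective _ _).ne_iff]
    exact fun h => by simpa using congrArg (Polynomial.eval 0) h
  rw [restrict_chromaticQuasisymmetric, restrict_sum]
  congr 1
  -- The automaton size is the maximum of the number of variables, beyond which `e_k` vanishes, and
  -- `n + 2`, the longest possible arc.
  have htrace := trace_pow_eq_of_charpolyRev_eq
    (charpolyRev_colorMatrix_eq hX MvPolynomial.X (le_max_left _ (n + 2))) (n + 1)
  rw [trace_transitionMatrix_pow (le_max_right _ _), ← sum_acyclicOrientations] at htrace
  refine Eq.trans ?_ (htrace.trans ?_)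
  · congr!
  refine Finset.sum_congr rfl fun lam _ => ?_
  rw [map_sum]
  simp only [map_pow]
  rfl

end Coloring

end ChromaticDigraph

end

theorem proposition6p7 (n : ℕ) (hn : 2 ≤ n) (c : n.Partition → Polynomial ℚ) :
    ChromaticDigraph.chromaticQuasisymmetric (ChromaticDigraph.directedCycle n) =
        ∑ lam : n.Partition, c lam • ChromaticDigraph.elementaryPart lam ↔
      ∀ lam : n.Partition, c lam =
        ∑ D ∈ ChromaticDigraph.acyclicOrientations lam,
          (Polynomial.X : Polynomial ℚ) ^
            ChromaticDigraph.orientationAsc (ChromaticDigraph.directedCycle n) D := by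
  obtain ⟨n, rfl⟩ := Nat.exists_eq_add_of_le' hn
  rw [ChromaticDigraph.chromaticQuasisymmetric_directedCycle, ← funext_iff]
  exact ⟨fun h => (ChromaticDigraph.elementaryPart_independent _ _ h).symm, fun h => by rw [h]⟩
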